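/- Let $(\mathcal{C},\mathbb{E},\mathfrak{s})$ be an extriangulated category in the sense of Nakaoka--Palu: $\mathcal{C}$ is an additive category, $\mathbb{E}:\mathcal{C}^{\mathrm{op}}\times\mathcal{C}\to \mathrm{Ab}$ is an additive bifunctor, and $\mathfrak{s}$ is an additive realization of $\mathbb{E}$, satisfying (ET3), (ET3)$^{\mathrm{op}}$, (ET4) and (ET4)$^{\mathrm{op}}$. An $\mathfrak{s}$-triangle $X_\bullet=(X_1\xrightarrow{f_1}X_2\xrightarrow{f_2}X_3\overset{\delta}{\dashrightarrow})$ consists of an element $\delta\in\mathbb{E}(X_3,X_1)$ and a sequence representing the equivalence class $\mathfrak{s}(\delta)$; then $f_1$ is called an $\mathfrak{s}$-inflation and $f_2$ an $\mathfrak{s}$-deflation. An object $P$ is projective if every morphism from $P$ to the target of an $\mathfrak{s}$-deflation $y$ factors through $y$, and $\mathcal{C}$ has enough projectives if every object $C$ admits an $\mathfrak{s}$-triangle $A\to P\to C\dashrightarrow$ with $P$ projective; injectives and enough injectives are defined dually. Let $\mathcal{P}$ and $\mathcal{I}$ be the classes of projective and injective objects, and let $[\mathcal{P}]$ and $[\mathcal{I}]$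 be the ideals of morphisms factoring through an object of $\mathcal{P}$, respectively $\mathcal{I}$. Let $\mathfrak{s}\text{-tri}(\mathcal{C})$ be the category of $\mathfrak{s}$-triangles, where a morphism from $X_\bullet$ to $Y_\bullet=(Y_1\xrightarrow{g_1}Y_2\xrightarrow{g_2}Y_3\overset{\delta'}{\dashrightarrow})$ is a triple $\varphi_\bullet=(\varphi_1,\varphi_2,\varphi_3)$ of morphisms $\varphi_i:X_i\to Y_i$ with $\varphi_2f_1=g_1\varphi_1$, $\varphi_3f_2=g_2\varphi_2$ and $\varphi_{1*}\delta=\varphi_3^*\delta'$. Let $\mathcal{R}_2$ be the ideal of $\mathfrak{s}\text{-tri}(\mathcal{C})$ consisting of the morphisms $\varphi_\bullet:X_\bullet\to Y_\bullet$ such that $\varphi_3$ factors through $g_2$. For a preadditive category $\mathcal{A}$, let $\mathrm{mod}\text{-}\mathcal{A}$ be the category of finitely presented right $\mathcal{A}$-modules, i.e. of contravariant additive functors $F:\mathcal{A}\to\mathrm{Ab}$ admitting an exact sequence $\mathcal{A}(-,X)\to\mathcal{A}(-,Y)\to F\to 0$ with $X,Y\in\mathcal{A}$. (1) If $\mathcal{C}$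 has enough projectives, then there is an equivalence of categories $\mathfrak{s}\text{-tri}(\mathcal{C})/\mathcal{R}_2\cong \mathrm{mod}\text{-}(\mathcal{C}/[\mathcal{P}])$. (2) If $\mathcal{C}$ has enough injectives, then there is an equivalence of categories $\mathfrak{s}\text{-tri}(\mathcal{C})/\mathcal{R}_2\cong \big(\mathrm{mod}\text{-}(\mathcal{C}/[\mathcal{I}])^{\mathrm{op}}\big)^{\mathrm{op}}$. -/

import Mathlib

open CategoryTheory CategoryTheory.Limits Opposite

universe w v u

namespace Extri

/-! ### Ideals of preadditive categories and ideal quotients -/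

/-- A two-sided ideal of a preadditive category: a subgroup of every group of morphisms, stable
under composition with arbitrary morphisms on both sides. -/
structure CatIdeal (C : Type u) [Category.{v} C] [Preadditive C] where
  hom : ∀ X Y : C, AddSubgroup (X ⟶ Y)
  comp_left : ∀ {X Y Z : C} (f : X ⟶ Y) {g : Y ⟶ Z}, g ∈ hom Y Z → f ≫ g ∈ hom X Z
  comp_right : ∀ {X Y Z : C} {f : X ⟶ Y} (g : Y ⟶ Z), f ∈ hom X Y → f ≫ g ∈ hom X Z

namespace CatIdeal

variable {C : Type u} [Category.{v} C] [Preadditive C] (J : CatIdeal C)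

/-- Two morphisms are identified modulo an ideal if their difference belongs to the ideal. -/
def rel : HomRel C := fun X Y f g => f - g ∈ J.hom X Y

instance : Congruence J.rel where
  equivalence :=
    { refl := fun f => by simp [rel, zero_mem]
      symm := fun {f g} h => by
        have := neg_mem (show f - g ∈ J.hom _ _ from h)
        rwa [neg_sub] at this
      trans := fun {f g k} h h' => by
        have := add_mem (show f - g ∈ J.hom _ _ from h) (show g - k ∈ J.hom _ _ from h')
        rwa [sub_add_sub_cancel] at this }
  comp_left f g g' h := by
    have := J.comp_left f (show g - g' ∈ J.hom _ _ from h)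
    rwa [Preadditive.comp_sub] at this
  comp_right {_ _ _ f f'} g h := by
    have := J.comp_right g (show f - f' ∈ J.hom _ _ from h)
    rwa [Preadditive.sub_comp] at this

/-- The ideal quotient `C/J`: same objects, morphisms are taken modulo `J`. -/
abbrev QuotientCat : Type u := CategoryTheory.Quotient J.rel

instance : Preadditive J.QuotientCat :=
  CategoryTheory.Quotient.preadditive J.rel (by
    intro X Y f₁ f₂ g₁ g₂ h h'
    have := add_mem (show f₁ - f₂ ∈ J.hom _ _ from h) (show g₁ - g₂ ∈ J.hom _ _ from h')
    rwa [← add_sub_add_comm] at this)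

end CatIdeal

/-- The ideal `[P]` of the morphisms that factor through an object of `P`, for a nonempty class
`P` of objects which is closed under binary direct sums. -/
def factorIdeal {C : Type u} [Category.{v} C] [Preadditive C] [HasBinaryBiproducts C]
    (P : ObjectProperty C) (h0 : ∃ Z : C, P Z)
    (hP : ∀ X Y : C, P X → P Y → P (X ⊞ Y)) : CatIdeal C where
  hom X Y :=
    { carrier := {f | ∃ (Z : C) (_ : P Z) (a : X ⟶ Z) (b : Z ⟶ Y), a ≫ b = f}
      zero_mem' := by
        obtain ⟨Z, hZ⟩ := h0
        exact ⟨Z, hZ, 0, 0, by simp⟩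
      add_mem' := by
        rintro _ _ ⟨Z, hZ, a, b, rfl⟩ ⟨Z', hZ', a', b', rfl⟩
        exact ⟨Z ⊞ Z', hP _ _ hZ hZ', biprod.lift a a', biprod.desc b b', by simp⟩
      neg_mem' := by
        rintro _ ⟨Z, hZ, a, b, rfl⟩
        exact ⟨Z, hZ, a, -b, by simp⟩ }
  comp_left := by
    rintro X Y Z f _ ⟨W, hW, a, b, rfl⟩
    exact ⟨W, hW, f ≫ a, b, by simp⟩
  comp_right := by
    rintro X Y Z _ g ⟨W, hW, a, b, rfl⟩
    exact ⟨W, hW, a, b ≫ g, by simp⟩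

/-! ### Finitely presented modules over a preadditive category -/

/-- A contravariant functor `F` to abelian groups is finitely presented if there is an exact
sequence `C(-,X) ⟶ C(-,Y) ⟶ F ⟶ 0`; exactness of functors is exactness at every object. -/
def IsFinitelyPresented {C : Type u} [Category.{v} C] [Preadditive C]
    (F : Cᵒᵖ ⥤ AddCommGrpCat.{v}) : Prop :=
  ∃ (X Y : C) (p : preadditiveYoneda.obj X ⟶ preadditiveYoneda.obj Y)
    (q : preadditiveYoneda.obj Y ⟶ F), ∀ Z : Cᵒᵖ,
      Function.Exact (p.app Z) (q.app Z) ∧ Function.Surjective (q.app Z)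

/-- The category `mod-C` of finitely presented right `C`-modules, a full subcategory of the
category of contravariant functors from `C` to abelian groups. -/
abbrev FPMod (C : Type u) [Category.{v} C] [Preadditive C] : Type max u (v + 1) :=
  ObjectProperty.FullSubcategory
    (fun F : Cᵒᵖ ⥤ AddCommGrpCat.{v} => F.Additive ∧ IsFinitelyPresented F)

/-! ### Extriangulated categories -/

section Extensions

variable {C : Type u} [Category.{v} C]

/-- A sequence of morphisms `A ⟶ B ⟶ D` with prescribed ends. -/
structure Sequence (A D : C) where
  mid : C
  x : A ⟶ mid
  y : mid ⟶ D

/-- Two sequences with the same ends are equivalent if there is an isomorphism between the middle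
terms which makes the diagram with identities at the ends commute. -/
instance sequenceSetoid (A D : C) : Setoid (Sequence A D) where
  r S T := ∃ b : S.mid ≅ T.mid, S.x ≫ b.hom = T.x ∧ b.hom ≫ T.y = S.y
  iseqv :=
    { refl := fun S => ⟨Iso.refl _, by simp, by simp⟩
      symm := by
        rintro S T ⟨b, h, h'⟩
        exact ⟨b.symm, by simp [← h], by simp [← h']⟩
      trans := by
        rintro S T U ⟨b, h, h'⟩ ⟨b', k, k'⟩
        exact ⟨b ≪≫ b', by simp [← k, ← h], by simp [← h', ← k']⟩ }

variable (E : Cᵒᵖ ⥤ C ⥤ AddCommGrpCat.{w})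

/-- The group `E(D, A)` of `E`-extensions. -/
abbrev Extension (D A : C) : Type w := (E.obj (op D)).obj A

variable {E}

/-- `a_* δ` for `a : A ⟶ A'` and `δ ∈ E(D, A)`. -/
abbrev push {D A A' : C} (a : A ⟶ A') (δ : Extension E D A) : Extension E D A' :=
  (E.obj (op D)).map a δ

/-- `c^* δ` for `c : D' ⟶ D` and `δ ∈ E(D, A)`. -/
abbrev pull {D D' A : C} (c : D' ⟶ D) (δ : Extension E D A) : Extension E D' A :=
  (E.map c.op).app A δ

lemma push_id {D A : C} (δ : Extension E D A) : push (𝟙 A) δ = δ :=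
  congrArg (fun t => t.hom δ) ((E.obj (op D)).map_id A)

lemma pull_id {D A : C} (δ : Extension E D A) : pull (𝟙 D) δ = δ :=
  congrArg (fun t => (t.app A).hom δ) (E.map_id (op D))

lemma push_comp {D A A' A'' : C} (a : A ⟶ A') (a' : A' ⟶ A'') (δ : Extension E D A) :
    push (a ≫ a') δ = push a' (push a δ) :=
  congrArg (fun t => t.hom δ) ((E.obj (op D)).map_comp a a')

lemma pull_comp {D D' D'' A : C} (c : D'' ⟶ D') (c' : D' ⟶ D) (δ : Extension E D A) :
    pull (c ≫ c') δ = pull c (pull c' δ) :=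
  congrArg (fun t => (t.app A).hom δ) (E.map_comp c'.op c.op)

lemma push_pull {D D' A A' : C} (a : A ⟶ A') (c : D' ⟶ D) (δ : Extension E D A) :
    push a (pull c δ) = pull c (push a δ) :=
  congrArg (fun t => t.hom δ) ((E.map c.op).naturality a).symm

/-- The direct sum `δ ⊕ δ'`: the element of `E(D ⊞ D', A ⊞ A')` with components `(δ, 0, 0, δ')`
in `E(D, A) ⊕ E(D, A') ⊕ E(D', A) ⊕ E(D', A')`. -/
noncomputable def extSum [Preadditive C] [HasBinaryBiproducts C] {D D' A A' : C}
    (δ : Extension E D A) (δ' : Extension E D' A') : Extension E (D ⊞ D') (A ⊞ A') :=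
  pull biprod.fst (push biprod.inl δ) + pull biprod.snd (push biprod.inr δ')

end Extensions

/-- The data `(E, s)` and the axioms (ET1), (ET2), (ET3), (ET3)ᵒᵖ, (ET4), (ET4)ᵒᵖ which make the
additive category `C` an extriangulated category. -/
structure Extriangulation (C : Type u) [Category.{v} C] [Preadditive C] [HasZeroObject C]
    [HasBinaryBiproducts C] where
  /-- (ET1) the bifunctor `E`, additive in both variables -/
  E : Cᵒᵖ ⥤ C ⥤ AddCommGrpCat.{w}
  additive_right : ∀ D : Cᵒᵖ, (E.obj D).Additive
  additive_left : ∀ A : C, (E.flip.obj A).Additive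
  /-- the correspondence `s`, from extensions to equivalence classes of sequences -/
  s : ∀ {D A : C}, Extension E D A → Quotient (sequenceSetoid A D)
  /-- (ET2) `s` is a realization: every morphism of extensions is realized by some triple -/
  realization : ∀ {A B D A' B' D' : C} {x : A ⟶ B} {y : B ⟶ D} {δ : Extension E D A}
    {x' : A' ⟶ B'} {y' : B' ⟶ D'} {δ' : Extension E D' A'},
    s δ = ⟦⟨B, x, y⟩⟧ → s δ' = ⟦⟨B', x', y'⟩⟧ →
    ∀ (a : A ⟶ A') (c : D ⟶ D'), push a δ = pull c δ' →
      ∃ b : B ⟶ B', x ≫ b = a ≫ x' ∧ y ≫ c = b ≫ y'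
  /-- (ET2) `s` sends zero to the split sequence -/
  s_zero : ∀ A D : C, s (0 : Extension E D A) = ⟦⟨A ⊞ D, biprod.inl, biprod.snd⟩⟧
  /-- (ET2) `s` is compatible with direct sums -/
  s_sum : ∀ {A B D A' B' D' : C} {x : A ⟶ B} {y : B ⟶ D} {δ : Extension E D A}
    {x' : A' ⟶ B'} {y' : B' ⟶ D'} {δ' : Extension E D' A'},
    s δ = ⟦⟨B, x, y⟩⟧ → s δ' = ⟦⟨B', x', y'⟩⟧ →
    s (extSum δ δ') = ⟦⟨B ⊞ B', biprod.map x x', biprod.map y y'⟩⟧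
  /-- (ET3) -/
  et3 : ∀ {A B D A' B' D' : C} {x : A ⟶ B} {y : B ⟶ D} {δ : Extension E D A}
    {x' : A' ⟶ B'} {y' : B' ⟶ D'} {δ' : Extension E D' A'},
    s δ = ⟦⟨B, x, y⟩⟧ → s δ' = ⟦⟨B', x', y'⟩⟧ →
    ∀ (a : A ⟶ A') (b : B ⟶ B'), x ≫ b = a ≫ x' →
      ∃ c : D ⟶ D', y ≫ c = b ≫ y' ∧ push a δ = pull c δ'
  /-- (ET3)ᵒᵖ -/
  et3op : ∀ {A B D A' B' D' : C} {x : A ⟶ B} {y : B ⟶ D} {δ : Extension E D A}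
    {x' : A' ⟶ B'} {y' : B' ⟶ D'} {δ' : Extension E D' A'},
    s δ = ⟦⟨B, x, y⟩⟧ → s δ' = ⟦⟨B', x', y'⟩⟧ →
    ∀ (b : B ⟶ B') (c : D ⟶ D'), y ≫ c = b ≫ y' →
      ∃ a : A ⟶ A', x ≫ b = a ≫ x' ∧ push a δ = pull c δ'
  /-- (ET4) -/
  et4 : ∀ {A B D K F : C} {f : A ⟶ B} {f' : B ⟶ D} {δ : Extension E D A}
    {g : B ⟶ K} {g' : K ⟶ F} {δ' : Extension E F B},
    s δ = ⟦⟨B, f, f'⟩⟧ → s δ' = ⟦⟨K, g, g'⟩⟧ →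
    ∃ (G : C) (h : A ⟶ K) (h' : K ⟶ G) (d : D ⟶ G) (e : G ⟶ F) (δ'' : Extension E G A),
      f ≫ g = h ∧ f' ≫ d = g ≫ h' ∧ h' ≫ e = g' ∧
      s δ'' = ⟦⟨K, h, h'⟩⟧ ∧ s (push f' δ') = ⟦⟨G, d, e⟩⟧ ∧
      δ = pull d δ'' ∧ push f δ'' = pull e δ'
  /-- (ET4)ᵒᵖ -/
  et4op : ∀ {D A B F K : C} {f' : D ⟶ A} {f : A ⟶ B} {δ : Extension E B D}
    {g' : F ⟶ B} {g : B ⟶ K} {δ' : Extension E K F},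
    s δ = ⟦⟨A, f', f⟩⟧ → s δ' = ⟦⟨B, g', g⟩⟧ →
    ∃ (G : C) (d : D ⟶ G) (e : G ⟶ F) (h' : G ⟶ A) (h : A ⟶ K) (δ'' : Extension E K G),
      d ≫ h' = f' ∧ e ≫ g' = h' ≫ f ∧ f ≫ g = h ∧
      s (pull g' δ) = ⟦⟨G, d, e⟩⟧ ∧ s δ'' = ⟦⟨A, h', h⟩⟧ ∧
      δ' = push e δ'' ∧ push d δ = pull g δ''

namespace Extriangulation

variable {C : Type u} [Category.{v} C] [Preadditive C] [HasZeroObject C] [HasBinaryBiproducts C]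
  (S : Extriangulation.{w} C)

/-- `A ⟶ B ⟶ D` together with `δ ∈ E(D, A)` is an `s`-triangle. -/
def IsTriangle {A B D : C} (x : A ⟶ B) (y : B ⟶ D) (δ : Extension S.E D A) : Prop :=
  S.s δ = ⟦⟨B, x, y⟩⟧

/-- `x` is an `s`-inflation. -/
def IsInflation {A B : C} (x : A ⟶ B) : Prop :=
  ∃ (D : C) (y : B ⟶ D) (δ : Extension S.E D A), S.IsTriangle x y δ

/-- `y` is an `s`-deflation. -/
def IsDeflation {B D : C} (y : B ⟶ D) : Prop :=
  ∃ (A : C) (x : A ⟶ B) (δ : Extension S.E D A), S.IsTriangle x y δ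

/-- The class of projective objects. -/
def projectives : ObjectProperty C := fun P =>
  ∀ ⦃B D : C⦄ (y : B ⟶ D), S.IsDeflation y → ∀ c : P ⟶ D, ∃ b : P ⟶ B, b ≫ y = c

/-- The class of injective objects. -/
def injectives : ObjectProperty C := fun I =>
  ∀ ⦃A B : C⦄ (x : A ⟶ B), S.IsInflation x → ∀ a : A ⟶ I, ∃ b : B ⟶ I, x ≫ b = a

/-- `C` has enough projectives. -/
def EnoughProjectives : Prop :=
  ∀ D : C, ∃ (A P : C) (x : A ⟶ P) (y : P ⟶ D) (δ : Extension S.E D A),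
    S.projectives P ∧ S.IsTriangle x y δ

/-- `C` has enough injectives. -/
def EnoughInjectives : Prop :=
  ∀ A : C, ∃ (I D : C) (x : A ⟶ I) (y : I ⟶ D) (δ : Extension S.E D A),
    S.injectives I ∧ S.IsTriangle x y δ

/-- The ideal `[P]` of the morphisms that factor through a projective object. -/
def projIdeal : CatIdeal C :=
  factorIdeal S.projectives
    (by
      obtain ⟨Z, hZ⟩ := HasZeroObject.zero (C := C)
      exact ⟨Z, fun B D y _ c => ⟨0, hZ.eq_of_src _ _⟩⟩)
    (by
      intro X Y hX hY B D y hy c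
      obtain ⟨b, hb⟩ := hX y hy (biprod.inl ≫ c)
      obtain ⟨b', hb'⟩ := hY y hy (biprod.inr ≫ c)
      exact ⟨biprod.desc b b', by ext <;> simp [hb, hb']⟩)

/-- The ideal `[I]` of the morphisms that factor through an injective object. -/
def injIdeal : CatIdeal C :=
  factorIdeal S.injectives
    (by
      obtain ⟨Z, hZ⟩ := HasZeroObject.zero (C := C)
      exact ⟨Z, fun A B x _ a => ⟨0, hZ.eq_of_tgt _ _⟩⟩)
    (by
      intro X Y hX hY A B x hx a
      obtain ⟨b, hb⟩ := hX x hx (a ≫ biprod.fst)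
      obtain ⟨b', hb'⟩ := hY x hx (a ≫ biprod.snd)
      exact ⟨biprod.lift b b', by ext <;> simp [hb, hb']⟩)

/-! ### The category of `s`-triangles -/

/-- The objects of `s-tri(C)`: the `s`-triangles `X₁ ⟶ X₂ ⟶ X₃` with class `δ`. -/
structure Tri where
  {X₁ X₂ X₃ : C}
  f₁ : X₁ ⟶ X₂
  f₂ : X₂ ⟶ X₃
  δ : Extension S.E X₃ X₁
  isTriangle : S.IsTriangle f₁ f₂ δ

variable {S}

/-- The morphisms of `s-tri(C)`. -/
@[ext]
structure TriHom (X Y : S.Tri) where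
  φ₁ : X.X₁ ⟶ Y.X₁
  φ₂ : X.X₂ ⟶ Y.X₂
  φ₃ : X.X₃ ⟶ Y.X₃
  comm₁ : X.f₁ ≫ φ₂ = φ₁ ≫ Y.f₁
  comm₂ : X.f₂ ≫ φ₃ = φ₂ ≫ Y.f₂
  ext_comm : push φ₁ X.δ = pull φ₃ Y.δ

instance : Category S.Tri where
  Hom := TriHom
  id X :=
    { φ₁ := 𝟙 _
      φ₂ := 𝟙 _
      φ₃ := 𝟙 _
      comm₁ := by simp
      comm₂ := by simp
      ext_comm := by rw [push_id, pull_id] }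
  comp {X Y Z} f g :=
    { φ₁ := f.φ₁ ≫ g.φ₁
      φ₂ := f.φ₂ ≫ g.φ₂
      φ₃ := f.φ₃ ≫ g.φ₃
      comm₁ := by rw [← Category.assoc, f.comm₁, Category.assoc, g.comm₁, Category.assoc]
      comm₂ := by rw [← Category.assoc, f.comm₂, Category.assoc, g.comm₂, Category.assoc]
      ext_comm := by
        have hf := f.ext_comm
        have hg := g.ext_comm
        rw [push_comp, hf, push_pull, hg, pull_comp] }
  id_comp f := TriHom.ext (Category.id_comp _) (Category.id_comp _) (Category.id_comp _)
  comp_id f := TriHom.ext (Category.comp_id _) (Category.comp_id _) (Category.comp_id _)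
  assoc f g h := TriHom.ext (Category.assoc _ _ _) (Category.assoc _ _ _) (Category.assoc _ _ _)

namespace Tri

variable {X Y Z : S.Tri}

@[ext]
lemma hom_ext {f g : X ⟶ Y} (h₁ : f.φ₁ = g.φ₁) (h₂ : f.φ₂ = g.φ₂) (h₃ : f.φ₃ = g.φ₃) :
    f = g :=
  TriHom.ext h₁ h₂ h₃

lemma pull_add {D D' A : C} (c c' : D' ⟶ D) (δ : Extension S.E D A) :
    pull (c + c') δ = pull c δ + pull c' δ := by
  have := S.additive_left A
  have h := (S.E.flip.obj A).map_add (f := c.op) (g := c'.op)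
  exact congrArg (fun t => t.hom δ) h

lemma push_add {D A A' : C} (a a' : A ⟶ A') (δ : Extension S.E D A) :
    push (a + a') δ = push a δ + push a' δ := by
  have := S.additive_right (op D)
  have h := (S.E.obj (op D)).map_add (f := a) (g := a')
  exact congrArg (fun t => t.hom δ) h

lemma pull_zero {D D' A : C} (δ : Extension S.E D A) : pull (0 : D' ⟶ D) δ = 0 := by
  have h := pull_add (0 : D' ⟶ D) 0 δ
  rwa [add_zero, left_eq_add] at h

lemma push_zero {D A A' : C} (δ : Extension S.E D A) : push (0 : A ⟶ A') δ = 0 := by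
  have h := push_add (0 : A ⟶ A') 0 δ
  rwa [add_zero, left_eq_add] at h

lemma pull_neg_hom {D D' A : C} (c : D' ⟶ D) (δ : Extension S.E D A) :
    pull (-c) δ = -pull c δ := by
  rw [eq_neg_iff_add_eq_zero, ← pull_add, neg_add_cancel, pull_zero]

lemma push_neg_hom {D A A' : C} (a : A ⟶ A') (δ : Extension S.E D A) :
    push (-a) δ = -push a δ := by
  rw [eq_neg_iff_add_eq_zero, ← push_add, neg_add_cancel, push_zero]

instance : Zero (X ⟶ Y) :=
  ⟨{ φ₁ := 0, φ₂ := 0, φ₃ := 0, comm₁ := by simp, comm₂ := by simp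
     ext_comm := by rw [push_zero, pull_zero] }⟩

instance : Add (X ⟶ Y) :=
  ⟨fun f g =>
    { φ₁ := f.φ₁ + g.φ₁, φ₂ := f.φ₂ + g.φ₂, φ₃ := f.φ₃ + g.φ₃
      comm₁ := by simp [f.comm₁, g.comm₁]
      comm₂ := by simp [f.comm₂, g.comm₂]
      ext_comm := by rw [push_add, pull_add, f.ext_comm, g.ext_comm] }⟩

instance : Neg (X ⟶ Y) :=
  ⟨fun f =>
    { φ₁ := -f.φ₁, φ₂ := -f.φ₂, φ₃ := -f.φ₃
      comm₁ := by simp [f.comm₁]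
      comm₂ := by simp [f.comm₂]
      ext_comm := by rw [push_neg_hom, pull_neg_hom, f.ext_comm] }⟩

instance : AddCommGroup (X ⟶ Y) where
  add_assoc f g h := hom_ext (add_assoc _ _ _) (add_assoc _ _ _) (add_assoc _ _ _)
  zero_add f := hom_ext (zero_add _) (zero_add _) (zero_add _)
  add_zero f := hom_ext (add_zero _) (add_zero _) (add_zero _)
  add_comm f g := hom_ext (add_comm _ _) (add_comm _ _) (add_comm _ _)
  neg_add_cancel f := hom_ext (neg_add_cancel _) (neg_add_cancel _) (neg_add_cancel _)
  nsmul := nsmulRec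
  zsmul := zsmulRec

/-- Morphisms of `s`-triangles are added componentwise. -/
instance : Preadditive S.Tri where
  add_comp _ _ _ f f' g := hom_ext (Preadditive.add_comp _ _ _ _ _ _)
    (Preadditive.add_comp _ _ _ _ _ _) (Preadditive.add_comp _ _ _ _ _ _)
  comp_add _ _ _ f g g' := hom_ext (Preadditive.comp_add _ _ _ _ _ _)
    (Preadditive.comp_add _ _ _ _ _ _) (Preadditive.comp_add _ _ _ _ _ _)

end Tri

variable (S)

/-- The ideal `R₂` of the morphisms of `s`-triangles whose third component factors through the
deflation of the target. -/
def R₂ : CatIdeal S.Tri where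
  hom X Y :=
    { carrier := {f | ∃ p : X.X₃ ⟶ Y.X₂, p ≫ Y.f₂ = f.φ₃}
      zero_mem' := ⟨0, zero_comp⟩
      add_mem' := by
        rintro f g ⟨p, hp⟩ ⟨q, hq⟩
        refine ⟨p + q, ?_⟩
        rw [Preadditive.add_comp, hp, hq]
        rfl
      neg_mem' := by
        rintro f ⟨p, hp⟩
        refine ⟨-p, ?_⟩
        rw [Preadditive.neg_comp, hp]
        rfl }
  comp_left := by
    rintro X Y Z f g ⟨p, hp⟩
    refine ⟨f.φ₃ ≫ p, ?_⟩
    rw [Category.assoc, hp]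
    rfl
  comp_right := by
    rintro X Y Z f g ⟨p, hp⟩
    refine ⟨p ≫ g.φ₂, ?_⟩
    rw [Category.assoc, ← g.comm₂, ← Category.assoc, hp]
    rfl

end Extriangulation

end Extri

/-!
A finitely presented right module over a preadditive category `A` is the cokernel of
`A(-, X) ⟶ A(-, Y)` for an arrow `f : X ⟶ Y`. By the Yoneda lemma the resulting functor from
arrows to modules is full and essentially surjective, and two squares induce the same morphism
exactly when their components on targets differ by a morphism that factors through the target
arrow (`cokerFunctor_map_eq_iff`, `cokerFunctor_full`, `cokerFunctor_essSurj`).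

With enough projectives, send an `s`-triangle to the cokernel of its deflation in `A = C/[P]`.
Morphisms in `[P]` into the end of an `s`-triangle factor through the deflation. Hence passing to
`C/[P]` neither enlarges the kernel of this functor, which is `R₂`, nor spoils fullness: a square
of deflations commuting modulo `[P]` can be corrected to commute, and (ET3)ᵒᵖ completes it to a
morphism of `s`-triangles. Every arrow `f : X ⟶ Y` has, modulo `[P]`, the same cokernel as
`(f, p) : X ⊞ P ⟶ Y` for a deflation `p` from a projective `P`, and `(f, p)` is a deflation
(`isDeflation_desc`, from (ET4)ᵒᵖ). So the functor is essentially surjective.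

With enough injectives the dual argument applies to inflations in `(C/[I])ᵒᵖ`. The kernel is again
`R₂`: for a morphism `φ` of `s`-triangles with classes `δ` and `δ'`, the component `φ₁` factors
through the inflation of the source iff `φ₁_* δ = φ₃^* δ'` vanishes, iff `φ₃` factors through the
deflation of the target (`Tri.factors_iff`).
-/

namespace Extri

/-! ### Cokernels of morphisms of representable modules -/

section Cokernel

variable {A : Type u} [Category.{v} A] [Preadditive A]

/-- The right module `Z ↦ A(Z, Y) / (f ∘ A(Z, X))` attached to an arrow `f : X ⟶ Y`, that is, the
cokernel of `A(-, X) ⟶ A(-, Y)`. -/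
def cokerYoneda (f : Arrow A) : Aᵒᵖ ⥤ AddCommGrpCat.{v} where
  obj Z := AddCommGrpCat.of
    ((Z.unop ⟶ f.right) ⧸ (Preadditive.rightComp Z.unop f.hom).range)
  map g := AddCommGrpCat.ofHom (QuotientAddGroup.map _ _ (Preadditive.leftComp f.right g.unop)
    (by
      rintro _ ⟨a, rfl⟩
      exact ⟨g.unop ≫ a, Category.assoc _ _ _⟩))
  map_id Z := by
    ext x
    exact congrArg (QuotientAddGroup.mk (s := (Preadditive.rightComp Z.unop f.hom).range))
      (Category.id_comp x)
  map_comp {Z Z' Z''} g g' := by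
    ext x
    exact congrArg (QuotientAddGroup.mk (s := (Preadditive.rightComp Z''.unop f.hom).range))
      (Category.assoc g'.unop g.unop x)

/-- The class in the cokernel of a morphism to the target of `f`. -/
def cokerMk (f : Arrow A) {Z : A} (x : Z ⟶ f.right) : (cokerYoneda f).obj (op Z) :=
  QuotientAddGroup.mk x

lemma cokerMk_surjective (f : Arrow A) (Z : A) :
    Function.Surjective (cokerMk f : (Z ⟶ f.right) → (cokerYoneda f).obj (op Z)) :=
  QuotientAddGroup.mk_surjective

lemma cokerMk_eq_zero_iff (f : Arrow A) {Z : A} (x : Z ⟶ f.right) :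
    cokerMk f x = 0 ↔ ∃ a : Z ⟶ f.left, a ≫ f.hom = x :=
  QuotientAddGroup.eq_zero_iff x

lemma cokerMk_eq_iff (f : Arrow A) {Z : A} (x y : Z ⟶ f.right) :
    cokerMk f x = cokerMk f y ↔ ∃ a : Z ⟶ f.left, a ≫ f.hom = x - y := by
  rw [← cokerMk_eq_zero_iff, ← sub_eq_zero]
  rfl

lemma cokerYoneda_map (f : Arrow A) {Z Z' : A} (g : Z' ⟶ Z) (x : Z ⟶ f.right) :
    (cokerYoneda f).map g.op (cokerMk f x) = cokerMk f (g ≫ x) := rfl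

/-- A morphism out of a cokernel of representable modules is determined by the class of the
identity. -/
lemma cokerYoneda_hom_apply {f : Arrow A} {F : Aᵒᵖ ⥤ AddCommGrpCat.{v}} (η : cokerYoneda f ⟶ F)
    {Z : A} (x : Z ⟶ f.right) :
    η.app (op Z) (cokerMk f x) = F.map x.op (η.app (op f.right) (cokerMk f (𝟙 _))) := by
  have h := NatTrans.naturality_apply η x.op (cokerMk f (𝟙 _))
  rw [cokerYoneda_map, Category.comp_id] at h
  exact h

lemma cokerYoneda_hom_ext {f : Arrow A} {F : Aᵒᵖ ⥤ AddCommGrpCat.{v}} {η θ : cokerYoneda f ⟶ F}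
    (h : η.app (op f.right) (cokerMk f (𝟙 _)) = θ.app (op f.right) (cokerMk f (𝟙 _))) : η = θ := by
  ext Z x
  obtain ⟨x, rfl⟩ := cokerMk_surjective f Z.unop x
  exact (cokerYoneda_hom_apply η x).trans ((congrArg _ h).trans (cokerYoneda_hom_apply θ x).symm)

/-- The projection from the representable module to the cokernel. -/
def cokerProj (f : Arrow A) : preadditiveYoneda.obj f.right ⟶ cokerYoneda f where
  app Z := AddCommGrpCat.ofHom
    (QuotientAddGroup.mk' (Preadditive.rightComp Z.unop f.hom).range)
  naturality _ _ _ := rfl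

lemma cokerYoneda_additive (f : Arrow A) : (cokerYoneda f).Additive where
  map_add {Z Z'} g g' := by
    ext x
    obtain ⟨x, rfl⟩ := cokerMk_surjective f Z.unop x
    exact congrArg (cokerMk f) (Preadditive.add_comp _ _ _ g.unop g'.unop x)

lemma cokerYoneda_isFinitelyPresented (f : Arrow A) : IsFinitelyPresented (cokerYoneda f) :=
  ⟨f.left, f.right, preadditiveYoneda.map f.hom, cokerProj f, fun Z =>
    ⟨fun x => cokerMk_eq_zero_iff f (Z := Z.unop) x, cokerMk_surjective f Z.unop⟩⟩

/-- The morphism of cokernels induced by a commutative square. -/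
def cokerMap {f g : Arrow A} (φ : f ⟶ g) : cokerYoneda f ⟶ cokerYoneda g where
  app Z := AddCommGrpCat.ofHom (QuotientAddGroup.map _ _ (Preadditive.rightComp Z.unop φ.right)
    (by
      rintro _ ⟨a, rfl⟩
      refine ⟨a ≫ φ.left, ?_⟩
      simp [Preadditive.rightComp]))
  naturality Z Z' k := by
    ext x
    obtain ⟨x, rfl⟩ := cokerMk_surjective f Z.unop x
    exact congrArg (cokerMk g) (Category.assoc k.unop x φ.right)

lemma cokerMap_mk {f g : Arrow A} (φ : f ⟶ g) {Z : A} (x : Z ⟶ f.right) :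
    (cokerMap φ).app (op Z) (cokerMk f x) = cokerMk g (x ≫ φ.right) := rfl

/-- The functor from arrows to finitely presented modules that sends `f : X ⟶ Y` to the cokernel
of `A(-, X) ⟶ A(-, Y)`. -/
def cokerFunctor (A : Type u) [Category.{v} A] [Preadditive A] : Arrow A ⥤ FPMod A where
  obj f := ⟨cokerYoneda f, cokerYoneda_additive f, cokerYoneda_isFinitelyPresented f⟩
  map φ := ObjectProperty.homMk (cokerMap φ)
  map_id f := by
    apply ObjectProperty.hom_ext
    apply cokerYoneda_hom_ext
    exact congrArg (cokerMk f) (Category.comp_id _)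
  map_comp {f g h} φ ψ := by
    apply ObjectProperty.hom_ext
    apply cokerYoneda_hom_ext
    exact congrArg (cokerMk h) (Category.assoc _ _ _).symm

lemma cokerFunctor_map_eq_iff {f g : Arrow A} (φ ψ : f ⟶ g) :
    (cokerFunctor A).map φ = (cokerFunctor A).map ψ ↔
      ∃ a : f.right ⟶ g.left, a ≫ g.hom = φ.right - ψ.right := by
  rw [← cokerMk_eq_iff]
  have key : ∀ χ : f ⟶ g,
      (cokerMap χ).app (op f.right) (cokerMk f (𝟙 _)) = cokerMk g χ.right := fun χ => by
    rw [cokerMap_mk, Category.id_comp]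
  constructor
  · intro h
    have h' : cokerMap φ = cokerMap ψ := congrArg (fun t => t.hom) h
    rw [← key, ← key, h']
  · intro h
    apply ObjectProperty.hom_ext
    apply cokerYoneda_hom_ext
    exact (key φ).trans (h.trans (key ψ).symm)

/-- Representable modules are projective, so every morphism of cokernels lifts to a square. -/
instance cokerFunctor_full : (cokerFunctor A).Full where
  map_surjective {f g} η := by
    let θ : cokerYoneda f ⟶ cokerYoneda g := η.hom
    obtain ⟨u, hu⟩ := cokerMk_surjective g f.right (θ.app (op f.right) (cokerMk f (𝟙 _)))
    have hx : ∀ {Z : A} (x : Z ⟶ f.right),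
        θ.app (op Z) (cokerMk f x) = cokerMk g (x ≫ u) := fun x => by
      rw [cokerYoneda_hom_apply, ← hu]
      rfl
    have h0 : cokerMk f f.hom = 0 := (cokerMk_eq_zero_iff f _).2 ⟨𝟙 _, Category.id_comp _⟩
    obtain ⟨a, ha⟩ := (cokerMk_eq_zero_iff g (f.hom ≫ u)).1 (by rw [← hx, h0, map_zero])
    refine ⟨Arrow.homMk a u ha, ?_⟩
    apply ObjectProperty.hom_ext
    apply cokerYoneda_hom_ext
    exact (congrArg (cokerMk g) (Category.id_comp u)).trans hu

/-- Arrows with the same target that factor through each other have isomorphic cokernels. -/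
lemma nonempty_cokerFunctor_iso {X X' Y : A} {f : X ⟶ Y} {f' : X' ⟶ Y} (a : X ⟶ X')
    (b : X' ⟶ X) (ha : a ≫ f' = f) (hb : b ≫ f = f') :
    Nonempty ((cokerFunctor A).obj (Arrow.mk f) ≅ (cokerFunctor A).obj (Arrow.mk f')) := by
  refine ⟨⟨(cokerFunctor A).map (Arrow.homMk a (𝟙 Y) (by simpa using ha)),
    (cokerFunctor A).map (Arrow.homMk b (𝟙 Y) (by simpa using hb)), ?_, ?_⟩⟩
  all_goals
    rw [← Functor.map_comp, ← CategoryTheory.Functor.map_id, cokerFunctor_map_eq_iff]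
    exact ⟨0, by simp⟩

/-- Evaluation of a morphism out of a representable module, by the Yoneda lemma. -/
lemma yoneda_hom_apply {Y : A} {F : Aᵒᵖ ⥤ AddCommGrpCat.{v}} (η : preadditiveYoneda.obj Y ⟶ F)
    {Z : A} (x : Z ⟶ Y) : η.app (op Z) x = F.map x.op (η.app (op Y) (𝟙 Y)) := by
  have h := NatTrans.naturality_apply η x.op (𝟙 Y)
  exact (congrArg (η.app (op Z)) (Category.comp_id x).symm).trans h

instance cokerFunctor_essSurj : (cokerFunctor A).EssSurj where
  mem_essImage F := by
    obtain ⟨X, Y, p, q, h⟩ := F.property.2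
    let f : X ⟶ Y := p.app (op X) (𝟙 X)
    have hp : ∀ {Z : A} (x : Z ⟶ X), p.app (op Z) x = x ≫ f := fun x => yoneda_hom_apply p x
    let D (Z : Aᵒᵖ) : AddCommGrpCat.of
        ((Z.unop ⟶ Y) ⧸ (Preadditive.rightComp Z.unop f).range) ⟶ F.obj.obj Z :=
      AddCommGrpCat.ofHom (QuotientAddGroup.lift _ (q.app Z).hom (by
        rintro _ ⟨a, rfl⟩
        exact ((h Z).1 _).2 ⟨a, hp a⟩))
    have hD (Z : Aᵒᵖ) : IsIso (D Z) := by
      refine (ConcreteCategory.isIso_iff_bijective (D Z)).2 ⟨?_, ?_⟩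
      · refine (injective_iff_map_eq_zero (D Z).hom).2 fun x hx => ?_
        obtain ⟨x, rfl⟩ := QuotientAddGroup.mk_surjective x
        obtain ⟨a, ha⟩ := ((h Z).1 x).1 hx
        exact (QuotientAddGroup.eq_zero_iff x).2 ⟨a, (hp (Z := Z.unop) a).symm.trans ha⟩
      · intro y
        obtain ⟨x, hx⟩ := (h Z).2 y
        exact ⟨QuotientAddGroup.mk x, hx⟩
    refine ⟨Arrow.mk f, ⟨ObjectProperty.isoMk _
      (NatIso.ofComponents (fun Z => @asIso _ _ _ _ (D Z) (hD Z)) ?_)⟩⟩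
    intro Z Z' g
    ext x
    obtain ⟨x, rfl⟩ := cokerMk_surjective (Arrow.mk f) Z.unop x
    exact NatTrans.naturality_apply q g x

end Cokernel

/-! ### Equivalences out of ideal quotients -/

namespace CatIdeal

variable {C : Type u} [Category.{v} C] [Preadditive C] (J : CatIdeal C)

/-- The projection `C ⥤ C/J`. -/
abbrev proj : C ⥤ J.QuotientCat := CategoryTheory.Quotient.functor J.rel

instance : J.proj.Additive where
  map_add := rfl

lemma proj_map_eq_iff {X Y : C} (f g : X ⟶ Y) :
    J.proj.map f = J.proj.map g ↔ f - g ∈ J.hom X Y :=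
  CategoryTheory.Quotient.functor_map_eq_iff J.rel f g

/-- A full and essentially surjective functor that identifies exactly the morphisms congruent
modulo `J` induces an equivalence from the quotient by `J`. -/
lemma nonempty_quotientCat_equivalence {D : Type*} [Category* D] (G : C ⥤ D) [G.Full]
    [G.EssSurj] (h : ∀ {X Y : C} (f g : X ⟶ Y), f - g ∈ J.hom X Y ↔ G.map f = G.map g) :
    Nonempty (J.QuotientCat ≌ D) := by
  let L : J.QuotientCat ⥤ D :=
    CategoryTheory.Quotient.lift J.rel G fun _ _ f g hfg => (h f g).1 hfg
  have : L.Full :=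
    ⟨fun {X Y} k => by
      obtain ⟨f, hf⟩ := G.map_surjective (X := X.as) (Y := Y.as) k
      exact ⟨J.proj.map f, hf⟩⟩
  have : L.Faithful :=
    ⟨fun {X Y} k k' hk => by
      obtain ⟨f, rfl⟩ := J.proj.map_surjective (X := X.as) (Y := Y.as) k
      obtain ⟨g, rfl⟩ := J.proj.map_surjective (X := X.as) (Y := Y.as) k'
      exact (J.proj_map_eq_iff f g).2 ((h f g).2 hk)⟩
  have : L.EssSurj :=
    ⟨fun d => ⟨J.proj.obj (G.objPreimage d), ⟨G.objObjPreimageIso d⟩⟩⟩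
  have : L.IsEquivalence := { }
  exact ⟨L.asEquivalence⟩

end CatIdeal

namespace Extriangulation

variable {C : Type u} [Category.{v} C] [Preadditive C] [HasZeroObject C] [HasBinaryBiproducts C]
  (S : Extriangulation.{w} C)

/-! ### Exactness and inflations, deflations -/

variable {S} in
lemma IsTriangle.of_iso {A B B' D : C} {x : A ⟶ B} {y : B ⟶ D} {δ : Extension S.E D A}
    (h : S.IsTriangle x y δ) (e : B ≅ B') {x' : A ⟶ B'} {y' : B' ⟶ D} (hx : x ≫ e.hom = x')
    (hy : e.hom ≫ y' = y) : S.IsTriangle x' y' δ :=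
  Eq.trans h (Quotient.sound ⟨e, hx, hy⟩)

lemma isTriangle_split (A D : C) :
    S.IsTriangle (biprod.inl : A ⟶ A ⊞ D) biprod.snd (0 : Extension S.E D A) :=
  S.s_zero A D

section Triangle

variable {S} {A B D : C} {x : A ⟶ B} {y : B ⟶ D} {δ : Extension S.E D A}

/-- Exactness of `C(B, Z) ⟶ C(A, Z) ⟶ E(D, Z)`. -/
lemma IsTriangle.push_eq_zero_iff (h : S.IsTriangle x y δ) {Z : C} (a : A ⟶ Z) :
    push a δ = 0 ↔ ∃ b : B ⟶ Z, x ≫ b = a := by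
  constructor
  · intro ha
    obtain ⟨b, hb, -⟩ := S.realization h (S.isTriangle_split Z D) a (𝟙 D) (by rw [ha, pull_id])
    exact ⟨b ≫ biprod.fst, by rw [← Category.assoc, hb]; simp⟩
  · rintro ⟨b, rfl⟩
    obtain ⟨c, -, hc⟩ := S.et3 h (S.isTriangle_split Z D) (x ≫ b) (b ≫ biprod.inl) (by simp)
    exact hc.trans (map_zero _)

/-- Exactness of `C(Z, B) ⟶ C(Z, D) ⟶ E(Z, A)`. -/
lemma IsTriangle.pull_eq_zero_iff (h : S.IsTriangle x y δ) {Z : C} (c : Z ⟶ D) :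
    pull c δ = 0 ↔ ∃ b : Z ⟶ B, b ≫ y = c := by
  constructor
  · intro hc
    obtain ⟨b, -, hb⟩ := S.realization (S.isTriangle_split A Z) h (𝟙 A) c (by rw [hc, push_id])
    exact ⟨biprod.inr ≫ b, by rw [Category.assoc, ← hb]; simp⟩
  · rintro ⟨b, rfl⟩
    obtain ⟨a, -, ha⟩ := S.et3op (S.isTriangle_split A Z) h (biprod.snd ≫ b) (b ≫ y) (by simp)
    exact ha.symm.trans (map_zero _)

end Triangle

open scoped ZeroObject

lemma isTriangle_id_right (D : C) :
    S.IsTriangle (0 : (0 : C) ⟶ D) (𝟙 D) (0 : Extension S.E D (0 : C)) :=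
  (S.isTriangle_split 0 D).of_iso
    ⟨biprod.snd, biprod.inr, biprod.hom_ext _ _ ((isZero_zero C).eq_of_tgt _ _) (by simp), by simp⟩
    ((isZero_zero C).eq_of_src _ _) (by simp)

lemma isTriangle_id_left (A : C) :
    S.IsTriangle (𝟙 A) (0 : A ⟶ (0 : C)) (0 : Extension S.E (0 : C) A) :=
  (S.isTriangle_split A 0).of_iso
    ⟨biprod.fst, biprod.inl, biprod.hom_ext _ _ (by simp) ((isZero_zero C).eq_of_tgt _ _), by simp⟩
    (by simp) ((isZero_zero C).eq_of_tgt _ _)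

/-- A deflation stays a deflation after adding any morphism with the same target: it is the
composite of `𝟙 ⊞ p` with the split deflation `X ⊞ Y ⟶ Y` given by `f` and `𝟙`. -/
lemma isDeflation_desc {X P Y : C} (f : X ⟶ Y) {p : P ⟶ Y} (hp : S.IsDeflation p) :
    S.IsDeflation (biprod.desc f p) := by
  obtain ⟨A, x, δ, h⟩ := hp
  have h₁ : S.IsTriangle (biprod.map 0 x) (biprod.map (𝟙 X) p) _ :=
    S.s_sum (S.isTriangle_id_right X) h
  have h₂ : S.IsTriangle (biprod.lift (𝟙 X) (-f)) (biprod.desc f (𝟙 Y)) 0 :=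
    (S.isTriangle_split X Y).of_iso
      ⟨biprod.lift biprod.fst (biprod.snd - biprod.fst ≫ f),
        biprod.lift biprod.fst (biprod.snd + biprod.fst ≫ f), by ext <;> simp, by ext <;> simp⟩
      (by ext <;> simp) (by ext <;> simp)
  obtain ⟨G, -, -, h', k, δ', -, -, hk, -, ht, -⟩ := S.et4op h₁ h₂
  have hk' : k = biprod.desc f p := by
    rw [← hk]
    ext <;> simp
  exact ⟨G, h', δ', hk' ▸ ht⟩

/-- An inflation stays an inflation after adding any morphism with the same source: it is the
composite of the split inflation `X ⟶ X ⊞ Y` given by `𝟙` and `f` with `i ⊞ 𝟙`. -/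
lemma isInflation_lift {X I Y : C} (f : X ⟶ Y) {i : X ⟶ I} (hi : S.IsInflation i) :
    S.IsInflation (biprod.lift f i) := by
  obtain ⟨D, y, δ, h⟩ := hi
  have h₁ : S.IsTriangle (biprod.map (𝟙 Y) i) (biprod.map 0 y) _ :=
    S.s_sum (S.isTriangle_id_left Y) h
  have h₂ : S.IsTriangle (biprod.lift f (𝟙 X)) (biprod.desc (𝟙 Y) (-f)) 0 :=
    (S.isTriangle_split X Y).of_iso
      ⟨biprod.desc (biprod.lift f (𝟙 X)) biprod.inl,
        biprod.lift biprod.snd (biprod.fst - biprod.snd ≫ f), by ext <;> simp, by ext <;> simp⟩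
      (by simp) (by ext <;> simp)
  obtain ⟨G, k, h', -, -, δ', hk, -, -, ht, -⟩ := S.et4 h₂ h₁
  have hk' : k = biprod.lift f i := by
    rw [← hk]
    ext <;> simp
  exact ⟨G, h', δ', hk' ▸ ht⟩

lemma Tri.sub_φ₁ {X Y : S.Tri} (φ ψ : X ⟶ Y) : (φ - ψ).φ₁ = φ.φ₁ - ψ.φ₁ :=
  (sub_eq_add_neg _ _).symm

lemma Tri.sub_φ₃ {X Y : S.Tri} (φ ψ : X ⟶ Y) : (φ - ψ).φ₃ = φ.φ₃ - ψ.φ₃ :=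
  (sub_eq_add_neg _ _).symm

/-- Both factorizations express the vanishing of the extension `φ₁_* δ = φ₃^* δ'`. -/
lemma Tri.factors_iff {X Y : S.Tri} (φ : X ⟶ Y) :
    (∃ p : X.X₃ ⟶ Y.X₂, p ≫ Y.f₂ = φ.φ₃) ↔ ∃ q : X.X₂ ⟶ Y.X₁, X.f₁ ≫ q = φ.φ₁ := by
  rw [← Y.isTriangle.pull_eq_zero_iff, ← X.isTriangle.push_eq_zero_iff, φ.ext_comm]

/-! ### Modules over the quotient by the projectives -/

variable {S} in
lemma factors_of_mem_projIdeal {X B D : C} {y : B ⟶ D} (hy : S.IsDeflation y) {c : X ⟶ D}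
    (hc : c ∈ S.projIdeal.hom X D) : ∃ b : X ⟶ B, b ≫ y = c := by
  obtain ⟨P, hP, a, b, rfl⟩ := hc
  obtain ⟨b', rfl⟩ := hP y hy b
  exact ⟨a ≫ b', Category.assoc _ _ _⟩

/-- Sends an `s`-triangle to its deflation, taken modulo `[P]`. -/
def deflationArrow : S.Tri ⥤ Arrow S.projIdeal.QuotientCat where
  obj X := Arrow.mk (S.projIdeal.proj.map X.f₂)
  map φ := Arrow.homMk (S.projIdeal.proj.map φ.φ₂)
    (S.projIdeal.proj.map φ.φ₃)
    (congrArg S.projIdeal.proj.map φ.comm₂.symm)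

/-- The functor that sends an `s`-triangle to the cokernel of the morphism represented by its
deflation, as a module over `C/[P]`. -/
def deflationModule : S.Tri ⥤ FPMod S.projIdeal.QuotientCat :=
  S.deflationArrow ⋙ cokerFunctor _

lemma deflationModule_map_eq_iff {X Y : S.Tri} (φ ψ : X ⟶ Y) :
    φ - ψ ∈ S.R₂.hom X Y ↔ S.deflationModule.map φ = S.deflationModule.map ψ := by
  refine Iff.trans ?_ (cokerFunctor_map_eq_iff _ _).symm
  change (∃ p : X.X₃ ⟶ Y.X₂, p ≫ Y.f₂ = (φ - ψ).φ₃) ↔ _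
  rw [Tri.sub_φ₃]
  constructor
  · rintro ⟨p, hp⟩
    exact ⟨S.projIdeal.proj.map p,
      congrArg S.projIdeal.proj.map (hp.trans (sub_eq_add_neg _ _))⟩
  · rintro ⟨p, hp⟩
    obtain ⟨p, rfl⟩ := S.projIdeal.proj.map_surjective
      (X := X.X₃) (Y := Y.X₂) p
    have hp' := (S.projIdeal.proj_map_eq_iff (p ≫ Y.f₂) (φ.φ₃ - ψ.φ₃)).1
      (hp.trans (Functor.map_sub S.projIdeal.proj).symm)
    obtain ⟨b, hb⟩ := factors_of_mem_projIdeal ⟨_, _, _, Y.isTriangle⟩ hp'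
    exact ⟨p - b, by rw [Preadditive.sub_comp, hb, sub_sub_cancel]⟩

instance deflationModule_full : S.deflationModule.Full where
  map_surjective {X Y} η := by
    obtain ⟨θ, rfl⟩ := (cokerFunctor _).map_surjective η
    obtain ⟨c, hc⟩ := S.projIdeal.proj.map_surjective
      (X := X.X₃) (Y := Y.X₃) θ.right
    obtain ⟨b, hb⟩ := S.projIdeal.proj.map_surjective
      (X := X.X₂) (Y := Y.X₂) θ.left
    have hw := θ.w
    rw [← hb, ← hc] at hw
    -- the square commutes only modulo `[P]`; the error factors through the deflation of `Y`
    obtain ⟨e, he⟩ := factors_of_mem_projIdeal ⟨_, _, _, Y.isTriangle⟩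
      ((S.projIdeal.proj_map_eq_iff (X.f₂ ≫ c) (b ≫ Y.f₂)).1 hw.symm)
    have hcomm : X.f₂ ≫ c = (b + e) ≫ Y.f₂ := by
      rw [Preadditive.add_comp, he, add_sub_cancel]
    obtain ⟨a, ha, hδ⟩ := S.et3op X.isTriangle Y.isTriangle (b + e) c hcomm
    let φ : X ⟶ Y := ⟨a, b + e, c, ha, hcomm, hδ⟩
    refine ⟨φ, (cokerFunctor_map_eq_iff _ _).2 ⟨0, ?_⟩⟩
    rw [zero_comp, ← hc]
    exact (sub_self _).symm

lemma deflationModule_essSurj (hS : S.EnoughProjectives) : S.deflationModule.EssSurj where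
  mem_essImage F := by
    obtain ⟨f, ⟨e⟩⟩ :=
      Functor.EssSurj.mem_essImage (F := cokerFunctor S.projIdeal.QuotientCat) F
    obtain ⟨X, Y, f, rfl⟩ := Arrow.mk_surjective f
    obtain ⟨f, rfl⟩ := S.projIdeal.proj.map_surjective
      (X := X.as) (Y := Y.as) f
    obtain ⟨A, P, x, p, δ, hP, h⟩ := hS Y.as
    obtain ⟨K, k, δ', hK⟩ := S.isDeflation_desc f ⟨A, x, δ, h⟩
    let T : S.Tri := ⟨k, biprod.desc f p, δ', hK⟩
    -- `f` and `(f, p)` factor through each other modulo `[P]`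
    obtain ⟨i⟩ := nonempty_cokerFunctor_iso
      (f := S.projIdeal.proj.map (biprod.desc f p))
      (f' := S.projIdeal.proj.map f)
      (S.projIdeal.proj.map biprod.fst)
      (S.projIdeal.proj.map biprod.inl)
      (by
        rw [← Functor.map_comp, CatIdeal.proj_map_eq_iff]
        exact ⟨P, hP, -biprod.snd, p, by ext <;> simp⟩)
      (by rw [← Functor.map_comp, biprod.inl_desc])
    exact ⟨T, ⟨i ≪≫ e⟩⟩

/-! ### Modules over the quotient by the injectives -/

variable {S} in
lemma factors_of_mem_injIdeal {A B Y : C} {x : A ⟶ B} (hx : S.IsInflation x) {c : A ⟶ Y}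
    (hc : c ∈ S.injIdeal.hom A Y) : ∃ b : B ⟶ Y, x ≫ b = c := by
  obtain ⟨I, hI, a, b, rfl⟩ := hc
  obtain ⟨a', rfl⟩ := hI x hx a
  exact ⟨a' ≫ b, (Category.assoc _ _ _).symm⟩

/-- Sends an `s`-triangle to its inflation, taken modulo `[I]` and regarded as an arrow of the
opposite category. -/
def inflationArrow : S.Tri ⥤ (Arrow S.injIdeal.QuotientCatᵒᵖ)ᵒᵖ where
  obj X := op (Arrow.mk (S.injIdeal.proj.map X.f₁).op)
  map φ := (Arrow.homMk (S.injIdeal.proj.map φ.φ₂).op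
    (S.injIdeal.proj.map φ.φ₁).op
    (congrArg (fun t => (S.injIdeal.proj.map t).op) φ.comm₁)).op

/-- The functor that sends an `s`-triangle to the cokernel of the morphism corepresented by its
inflation, as a left module over `C/[I]`. -/
def inflationModule : S.Tri ⥤ (FPMod (S.injIdeal.QuotientCat)ᵒᵖ)ᵒᵖ :=
  S.inflationArrow ⋙ (cokerFunctor _).op

lemma inflationModule_map_eq_iff {X Y : S.Tri} (φ ψ : X ⟶ Y) :
    φ - ψ ∈ S.R₂.hom X Y ↔ S.inflationModule.map φ = S.inflationModule.map ψ := by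
  refine Iff.trans ?_ (Quiver.Hom.op_inj.eq_iff.trans (cokerFunctor_map_eq_iff _ _)).symm
  refine (Tri.factors_iff S (φ - ψ)).trans ?_
  rw [Tri.sub_φ₁]
  constructor
  · rintro ⟨q, hq⟩
    exact ⟨(S.injIdeal.proj.map q).op,
      congrArg (fun t => (S.injIdeal.proj.map t).op)
        (hq.trans (sub_eq_add_neg _ _))⟩
  · rintro ⟨q, hq⟩
    obtain ⟨q, rfl⟩ : ∃ t, q = Quiver.Hom.op t := ⟨q.unop, rfl⟩
    obtain ⟨q, rfl⟩ := S.injIdeal.proj.map_surjective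
      (X := X.X₂) (Y := Y.X₁) q
    have hq' := (S.injIdeal.proj_map_eq_iff (X.f₁ ≫ q) (φ.φ₁ - ψ.φ₁)).1
      ((congrArg (fun t => t.unop) hq).trans (Functor.map_sub S.injIdeal.proj).symm)
    obtain ⟨b, hb⟩ := factors_of_mem_injIdeal ⟨_, _, _, X.isTriangle⟩ hq'
    exact ⟨q - b, by rw [Preadditive.comp_sub, hb, sub_sub_cancel]⟩

instance inflationModule_full : S.inflationModule.Full where
  map_surjective {X Y} η := by
    obtain ⟨η, rfl⟩ : ∃ t, η = Quiver.Hom.op t := ⟨η.unop, rfl⟩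
    obtain ⟨θ, rfl⟩ := (cokerFunctor _).map_surjective η
    obtain ⟨a, ha⟩ := S.injIdeal.proj.map_surjective
      (X := X.X₁) (Y := Y.X₁) θ.right.unop
    obtain ⟨b, hb⟩ := S.injIdeal.proj.map_surjective
      (X := X.X₂) (Y := Y.X₂) θ.left.unop
    have hw := congrArg (fun t => t.unop) θ.w
    have hw' : S.injIdeal.proj.map (X.f₁ ≫ b) =
        S.injIdeal.proj.map (a ≫ Y.f₁) := by
      rw [Functor.map_comp, Functor.map_comp, hb, ha]
      exact hw
    -- the square commutes only modulo `[I]`; the error factors through the inflation of `X`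
    obtain ⟨e, he⟩ := factors_of_mem_injIdeal ⟨_, _, _, X.isTriangle⟩
      ((S.injIdeal.proj_map_eq_iff (X.f₁ ≫ b) (a ≫ Y.f₁)).1 hw')
    have hcomm : X.f₁ ≫ (b - e) = a ≫ Y.f₁ := by
      rw [Preadditive.comp_sub, he, sub_sub_cancel]
    obtain ⟨c, hc, hδ⟩ := S.et3 X.isTriangle Y.isTriangle a (b - e) hcomm
    let φ : X ⟶ Y := ⟨a, b - e, c, hcomm, hc, hδ⟩
    refine ⟨φ, congrArg Quiver.Hom.op ((cokerFunctor_map_eq_iff _ _).2 ⟨0, ?_⟩)⟩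
    have ha' : (S.injIdeal.proj.map a).op = θ.right := congrArg Quiver.Hom.op ha
    rw [zero_comp, ← ha']
    exact (sub_self _).symm

lemma inflationModule_essSurj (hS : S.EnoughInjectives) : S.inflationModule.EssSurj where
  mem_essImage F := by
    obtain ⟨f, ⟨e⟩⟩ :=
      Functor.EssSurj.mem_essImage (F := cokerFunctor S.injIdeal.QuotientCatᵒᵖ) F.unop
    obtain ⟨Y, X, f, rfl⟩ := Arrow.mk_surjective f
    obtain ⟨f, rfl⟩ : ∃ t, f = Quiver.Hom.op t := ⟨f.unop, rfl⟩
    obtain ⟨f, rfl⟩ := S.injIdeal.proj.map_surjective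
      (X := X.unop.as) (Y := Y.unop.as) f
    obtain ⟨I, D, i, y, δ, hI, h⟩ := hS X.unop.as
    obtain ⟨K, k, δ', hK⟩ := S.isInflation_lift f ⟨D, y, δ, h⟩
    let T : S.Tri := ⟨biprod.lift f i, k, δ', hK⟩
    -- `f` and `(f, i)` factor through each other modulo `[I]`
    obtain ⟨j⟩ := nonempty_cokerFunctor_iso
      (f := (S.injIdeal.proj.map (biprod.lift f i)).op)
      (f' := (S.injIdeal.proj.map f).op)
      (S.injIdeal.proj.map biprod.inl).op
      (S.injIdeal.proj.map biprod.fst).op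
      (by
        rw [← op_comp, ← Functor.map_comp]
        refine congrArg Quiver.Hom.op ((CatIdeal.proj_map_eq_iff _ _ _).2 ?_)
        exact ⟨I, hI, -i, biprod.inr, by ext <;> simp⟩)
      (by rw [← op_comp, ← Functor.map_comp, biprod.lift_fst])
    exact ⟨T, ⟨(j ≪≫ e).symm.op⟩⟩

end Extriangulation

end Extri

theorem mainTheorem2 {C : Type u} [Category.{v} C] [Preadditive C] [HasZeroObject C]
    [HasBinaryBiproducts C] (S : Extri.Extriangulation.{w} C) :
    (S.EnoughProjectives →
      Nonempty (S.R₂.QuotientCat ≌ Extri.FPMod S.projIdeal.QuotientCat)) ∧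
    (S.EnoughInjectives →
      Nonempty (S.R₂.QuotientCat ≌ (Extri.FPMod (S.injIdeal.QuotientCat)ᵒᵖ)ᵒᵖ)) := by
  refine ⟨fun hS => ?_, fun hS => ?_⟩
  · have := S.deflationModule_essSurj hS
    exact S.R₂.nonempty_quotientCat_equivalence S.deflationModule S.deflationModule_map_eq_iff
  · have := S.inflationModule_essSurj hS
    exact S.R₂.nonempty_quotientCat_equivalence S.inflationModule S.inflationModule_map_eq_iff
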